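/- Let $p$ be a prime and let $(R,\mathfrak m)$ be a Noetherian normal local domain of characteristic $p$, with fraction field $K$, which is F-finite, i.e. the Frobenius map $R\to R$ is finite. Let $\Delta$ be an effective $\mathbb Q$-Weil divisor on $\operatorname{Spec} R$. For a $\mathbb Q$-Weil divisor $D$ put $R(D)=\{x\in K \mid \operatorname{div}_R(x)+D\ge 0\}$ (with $0 \in R(D)$), and for $q=p^e$ ($e \ge 0$) let ${}^eR((q-1)\Delta)$ be $R((q-1)\Delta)$ viewed as an $R$-module via the $e$-times iterated Frobenius map; it is isomorphic to $R((q-1)\Delta)^{1/q}$. The pair $(R,\Delta)$ is called strongly F-regular if for every nonzero $c\in R$ there is $q=p^e$ such that the inclusion $c^{1/q}R\hookrightarrow R((q-1)\Delta)^{1/q}$ splits as a homomorphism of $R$-modules. For $R$-modules $N\subseteq M$, the $\Delta$-tight closure $N_M^{*\Delta}\subseteq M$ is the set of all $z\in M$ for which there is a nonzero $c\in R$ such that, for all $q=p^e\gg 0$, the element $z\otimes c$ of $M\otimes_R{}^eR((q-1)\Delta)$ lies in the image of $N\otimes_R{}^eR((q-1)\Delta)$. Let $E$ be the injective hull of the residue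 field $R/\mathfrak m$. Then $(R,\Delta)$ is strongly F-regular if and only if $0_E^{*\Delta}=0$. -/

import Mathlib

open scoped TensorProduct

universe u v w

noncomputable section

namespace FPairs

/-! ### Injective hulls -/

/-- `ι : M → E` is an injective hull of `M`: an injective map into an injective module
which is an essential extension. -/
structure IsInjectiveHull {R : Type u} [CommRing R] {M E : Type v} [AddCommGroup M] [Module R M]
    [AddCommGroup E] [Module R E] (ι : M →ₗ[R] E) : Prop where
  injective_map : Function.Injective ι
  injective_module : Module.Injective R E
  essential : ∀ N : Submodule R E, N ≠ ⊥ → N ⊓ LinearMap.range ι ≠ ⊥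

/-! ### Frobenius pushforward -/

/-- `ᵉM`: the module `M` with scalars acting through the `e`-th iterate of Frobenius,
`r • m = r ^ (p ^ e) m`. For an `R`-submodule `M` of the fraction field `K`, the map
`m ↦ m ^ (1 / p ^ e)` identifies it with the `R`-module `M ^ (1 / p ^ e) ⊆ K ^ (1 / p ^ e)`. -/
def FrobeniusPushforward (_p _e : ℕ) (M : Type v) : Type v := M

namespace FrobeniusPushforward

variable (p e : ℕ) (M : Type v)

instance [AddCommGroup M] : AddCommGroup (FrobeniusPushforward p e M) :=
  inferInstanceAs (AddCommGroup M)

instance (R : Type u) [CommRing R] [ExpChar R p] [AddCommGroup M] [Module R M] :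
    Module R (FrobeniusPushforward p e M) :=
  Module.compHom M (iterateFrobenius R p e)

variable {M}

/-- An element of `M` seen in `ᵉM` (in root notation, `m` becomes `m ^ (1 / p ^ e)`). -/
def of (m : M) : FrobeniusPushforward p e M := m

variable {p e}

theorem smul_of {R : Type u} [CommRing R] [ExpChar R p] [AddCommGroup M] [Module R M]
    (r : R) (m : M) : r • of p e m = of p e (r ^ p ^ e • m) := rfl

/-- Functoriality of `ᵉM` in `M`. -/
def map {R : Type u} [CommRing R] [ExpChar R p] [AddCommGroup M] [Module R M]
    (f : M →ₗ[R] M) : FrobeniusPushforward p e M →ₗ[R] FrobeniusPushforward p e M where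
  toFun := f
  map_add' := f.map_add
  map_smul' r m := f.map_smul (iterateFrobenius R p e r) m

theorem map_of {R : Type u} [CommRing R] [ExpChar R p] [AddCommGroup M] [Module R M]
    (f : M →ₗ[R] M) (m : M) : map f (of p e m) = of p e (f m) := rfl

end FrobeniusPushforward

/-! ### `ℚ`-Weil divisors on the spectrum of a normal Noetherian domain -/

/-- A prime divisor on `Spec R`: a prime ideal of height one. -/
@[ext]
structure PrimeDivisor (R : Type u) [CommRing R] where
  asIdeal : Ideal R
  isPrime : asIdeal.IsPrime
  height_eq_one : asIdeal.height = 1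

attribute [instance] PrimeDivisor.isPrime

/-- A `ℚ`-Weil divisor on `Spec R`: a finite `ℚ`-linear combination of prime divisors. It is
effective when it is `≥ 0`, i.e. when all its coefficients are nonnegative. -/
abbrev QWeilDivisor (R : Type u) [CommRing R] : Type u := PrimeDivisor R →₀ ℚ

/-- The divisor `(q - 1) Δ` for `q = p ^ e`. -/
def scaled {R : Type u} [CommRing R] (p e : ℕ) (Δ : QWeilDivisor R) : QWeilDivisor R := ((p : ℚ) ^ e - 1) • Δ

theorem scaled_nonneg {R : Type u} [CommRing R] (p : ℕ) [ExpChar R p] (e : ℕ) {Δ : QWeilDivisor R} (hΔ : 0 ≤ Δ) :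
    0 ≤ scaled p e Δ := by
  intro P
  have hp : (1 : ℚ) ≤ p := by exact_mod_cast (expChar_pos R p)
  exact mul_nonneg (sub_nonneg.mpr (one_le_pow₀ hp)) (hΔ P)

section Divisors

variable {R : Type u} [CommRing R] [IsDomain R] (K : Type w) [Field K] [Algebra R K]
  [IsFractionRing R K]

/-- The local ring `R_P` at a prime divisor `P`, as a subring of the fraction field `K`. -/
abbrev PrimeDivisor.localRing (P : PrimeDivisor R) : Subalgebra R K :=
  Localization.subalgebra.ofField K P.asIdeal.primeCompl P.asIdeal.primeCompl_le_nonZeroDivisors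

instance (P : PrimeDivisor R) : IsLocalization.AtPrime (P.localRing K) P.asIdeal :=
  Localization.subalgebra.isLocalization_ofField K _ _

variable [IsNoetherianRing R] [IsIntegrallyClosed R]

instance (P : PrimeDivisor R) : IsDiscreteValuationRing (P.localRing K) := by
  have hloc : IsLocalization P.asIdeal.primeCompl (P.localRing K) :=
    Localization.subalgebra.isLocalization_ofField K _ _
  have h1 : IsNoetherianRing (P.localRing K) :=
    IsLocalization.isNoetherianRing P.asIdeal.primeCompl _ inferInstance
  have h2 : IsLocalRing (P.localRing K) := IsLocalization.AtPrime.isLocalRing _ P.asIdeal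
  have h3 : IsIntegrallyClosed (P.localRing K) :=
    isIntegrallyClosed_of_isLocalization _ P.asIdeal.primeCompl
      P.asIdeal.primeCompl_le_nonZeroDivisors
  have hdim : ringKrullDim (P.localRing K) = 1 := by
    rw [IsLocalization.AtPrime.ringKrullDim_eq_height P.asIdeal, P.height_eq_one]
    rfl
  have hnf : ¬ IsField (P.localRing K) := fun h => by
    rw [ringKrullDim_eq_zero_of_isField h] at hdim
    exact zero_ne_one hdim
  have hle : Ring.KrullDimLE 1 (P.localRing K) := Ring.krullDimLE_iff.mpr hdim.le
  have hP : ∃! Q : Ideal (P.localRing K), Q ≠ ⊥ ∧ Q.IsPrime := by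
    refine ⟨IsLocalRing.maximalIdeal _,
      ⟨fun h => hnf (IsLocalRing.isField_iff_maximalIdeal_eq.mpr h), inferInstance⟩, ?_⟩
    rintro Q ⟨hQ, hQ'⟩
    exact IsLocalRing.eq_maximalIdeal
      (Ring.krullDimLE_one_iff_of_noZeroDivisors.mp hle Q hQ hQ')
  have key : IsDiscreteValuationRing (P.localRing K) ↔ IsIntegrallyClosed (P.localRing K) ∧
      ∃! Q : Ideal (P.localRing K), Q ≠ ⊥ ∧ Q.IsPrime :=
    (IsDiscreteValuationRing.TFAE (P.localRing K) hnf).out 0 3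
  exact key.mpr ⟨h3, hP⟩

variable {K}

/-- The (multiplicative) valuation of `K` attached to a prime divisor `P`, i.e. the one of the
discrete valuation ring `R_P`. -/
def PrimeDivisor.valuation (P : PrimeDivisor R) : Valuation K (WithZero (Multiplicative ℤ)) :=
  (IsDiscreteValuationRing.maximalIdeal (P.localRing K)).valuation K

/-- The order of vanishing `ord_P x` of `x` along `P`, that is, the coefficient of `P` in `div x`
(meaningful for `x ≠ 0`). -/
def PrimeDivisor.ord (P : PrimeDivisor R) (x : K) : ℤ := -WithZero.log (P.valuation x)

theorem PrimeDivisor.ord_mul (P : PrimeDivisor R) {x y : K} (hx : x ≠ 0) (hy : y ≠ 0) :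
    P.ord (x * y) = P.ord x + P.ord y := by
  have hx' : P.valuation x ≠ 0 := (Valuation.ne_zero_iff _).mpr hx
  have hy' : P.valuation y ≠ 0 := (Valuation.ne_zero_iff _).mpr hy
  simp only [ord, map_mul, WithZero.log_mul hx' hy']
  ring

theorem PrimeDivisor.ord_add (P : PrimeDivisor R) {x y : K} (hx : x ≠ 0) (hy : y ≠ 0)
    (hxy : x + y ≠ 0) : min (P.ord x) (P.ord y) ≤ P.ord (x + y) := by
  have hx' : P.valuation x ≠ 0 := (Valuation.ne_zero_iff _).mpr hx
  have hy' : P.valuation y ≠ 0 := (Valuation.ne_zero_iff _).mpr hy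
  have hxy' : P.valuation (x + y) ≠ 0 := (Valuation.ne_zero_iff _).mpr hxy
  simp only [ord]
  rcases le_max_iff.mp (P.valuation.map_add x y) with h | h
  · exact (min_le_left _ _).trans (neg_le_neg ((WithZero.log_le_log hxy' hx').mpr h))
  · exact (min_le_right _ _).trans (neg_le_neg ((WithZero.log_le_log hxy' hy').mpr h))

theorem PrimeDivisor.ord_algebraMap_nonneg (P : PrimeDivisor R) {r : R} (hr : r ≠ 0) :
    0 ≤ P.ord (algebraMap R K r) := by
  have h0 : P.valuation (algebraMap R K r) ≠ 0 :=
    (Valuation.ne_zero_iff _).mpr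
      ((map_ne_zero_iff _ (IsFractionRing.injective R K)).mpr hr)
  have h1 : P.valuation (algebraMap R K r) ≤ 1 :=
    (IsDiscreteValuationRing.maximalIdeal (P.localRing K)).valuation_le_one
      (algebraMap R (P.localRing K) r)
  have := (WithZero.log_le_log h0 one_ne_zero).mpr h1
  rw [WithZero.log_one] at this
  simpa [ord] using this

variable (K)

/-- `R(D) = {x ∈ K | div x + D ≥ 0}` (with `0 ∈ R(D)`), an `R`-submodule of `K`. -/
def sections (D : QWeilDivisor R) : Submodule R K where
  carrier := {x | x ≠ 0 → ∀ P : PrimeDivisor R, 0 ≤ (P.ord x : ℚ) + D P}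
  zero_mem' := fun h => (h rfl).elim
  add_mem' := by
    intro x y hx hy hxy P
    by_cases hx0 : x = 0
    · subst hx0
      rw [zero_add] at hxy ⊢
      exact hy hxy P
    by_cases hy0 : y = 0
    · subst hy0
      rw [add_zero] at hxy ⊢
      exact hx hxy P
    have h1 := hx hx0 P
    have h2 := hy hy0 P
    rcases min_le_iff.mp (P.ord_add hx0 hy0 hxy) with h | h
    · have : (P.ord x : ℚ) ≤ P.ord (x + y) := by exact_mod_cast h
      linarith
    · have : (P.ord y : ℚ) ≤ P.ord (x + y) := by exact_mod_cast h
      linarith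
  smul_mem' := by
    intro r x hx hrx P
    rw [Algebra.smul_def] at hrx ⊢
    have hx0 : x ≠ 0 := right_ne_zero_of_mul hrx
    have hr0 : algebraMap R K r ≠ 0 := left_ne_zero_of_mul hrx
    have hr : r ≠ 0 := fun h => hr0 (by rw [h, map_zero])
    rw [P.ord_mul hr0 hx0]
    have h1 := hx hx0 P
    have h2 : (0 : ℚ) ≤ P.ord (algebraMap R K r) :=
      Int.cast_nonneg (P.ord_algebraMap_nonneg hr)
    rw [Int.cast_add]
    linarith

/-- For effective `D`, the inclusion `R ⊆ R(D)`. -/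
def toSections {D : QWeilDivisor R} (hD : 0 ≤ D) : R →ₗ[R] sections K D :=
  (Algebra.linearMap R K).codRestrict (sections K D) fun r h P => by
    have hr : r ≠ 0 := fun h' => h (by rw [h', map_zero])
    have h1 : (0 : ℚ) ≤ P.ord (algebraMap R K r) :=
      Int.cast_nonneg (P.ord_algebraMap_nonneg hr)
    have h2 : (0 : ℚ) ≤ D P := hD P
    simpa using add_nonneg h1 h2

/-- `ᵉR((q - 1)Δ)` for `q = p ^ e`; as an `R`-module this is `R((q - 1)Δ) ^ (1 / q)`. -/
abbrev FrobeniusTwist (p e : ℕ) (Δ : QWeilDivisor R) : Type w :=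
  FrobeniusPushforward p e (sections K (scaled p e Δ))

/-- The element `c` of `R ⊆ R((q - 1)Δ)` seen in `ᵉR((q - 1)Δ)`, i.e. `c ^ (1 / q)`. -/
def root (p : ℕ) [ExpChar R p] (e : ℕ) {Δ : QWeilDivisor R} (hΔ : 0 ≤ Δ) (c : R) :
    FrobeniusTwist K p e Δ :=
  FrobeniusPushforward.of p e (toSections K (scaled_nonneg p e hΔ) c)

/-- Strong F-regularity of the pair `(R, Δ)`: for every nonzero `c` there is `q = p ^ e` such that
the inclusion `c ^ (1 / q) R ⊆ R((q - 1)Δ) ^ (1 / q)` splits as a map of `R`-modules. -/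
def IsStronglyFRegular (p : ℕ) [ExpChar R p] {Δ : QWeilDivisor R} (hΔ : 0 ≤ Δ) : Prop :=
  ∀ c : R, c ≠ 0 → ∃ e : ℕ,
    ∃ g : FrobeniusTwist K p e Δ →ₗ[R] Submodule.span R {root K p e hΔ c},
      g ∘ₗ (Submodule.span R {root K p e hΔ c}).subtype = LinearMap.id

/-! ### `Δ`-tight closure -/

variable {M : Type v} [AddCommGroup M] [Module R M]

/-- `N^{[q]Δ}_M`: the image of `N ⊗ ᵉR((q - 1)Δ) → M ⊗ ᵉR((q - 1)Δ)`, for `q = p ^ e`. -/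
def frobeniusImage (p : ℕ) [ExpChar R p] (e : ℕ) (Δ : QWeilDivisor R) (N : Submodule R M) :
    Submodule R (M ⊗[R] FrobeniusTwist K p e Δ) :=
  LinearMap.range (LinearMap.rTensor (FrobeniusTwist K p e Δ) N.subtype)

/-- Multiplication by `d ∈ R` on the right factor `ᵉR((q - 1)Δ)`. -/
def rightMul (p : ℕ) [ExpChar R p] (e : ℕ) (Δ : QWeilDivisor R) (d : R) :
    FrobeniusTwist K p e Δ →ₗ[R] FrobeniusTwist K p e Δ :=
  FrobeniusPushforward.map (LinearMap.lsmul R (sections K (scaled p e Δ)) d)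

theorem rightMul_root (p : ℕ) [ExpChar R p] (e : ℕ) {Δ : QWeilDivisor R} (hΔ : 0 ≤ Δ) (d c : R) :
    rightMul K p e Δ d (root K p e hΔ c) = root K p e hΔ (d * c) := by
  rw [rightMul, root, FrobeniusPushforward.map_of, LinearMap.lsmul_apply, ← map_smul, smul_eq_mul]
  rfl

theorem tmul_root_mul_mem (p : ℕ) [ExpChar R p] (e : ℕ) {Δ : QWeilDivisor R} (hΔ : 0 ≤ Δ)
    (N : Submodule R M) (z : M) (c d : R)
    (h : z ⊗ₜ[R] root K p e hΔ c ∈ frobeniusImage K p e Δ N) :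
    z ⊗ₜ[R] root K p e hΔ (d * c) ∈ frobeniusImage K p e Δ N := by
  obtain ⟨t, ht⟩ := h
  refine ⟨LinearMap.lTensor N (rightMul K p e Δ d) t, ?_⟩
  rw [← LinearMap.comp_apply, LinearMap.rTensor_comp_lTensor, ← LinearMap.lTensor_comp_rTensor,
    LinearMap.comp_apply, ht, LinearMap.lTensor_tmul, rightMul_root]

/-- The `Δ`-tight closure `N^{*Δ}_M` of `N` in `M`: the set of all `z ∈ M` for which there is a
nonzero `c ∈ R` with `c z^q = z ⊗ c ∈ N^{[q]Δ}_M` for all `q = p ^ e ≫ 0`. -/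
def tightClosure (p : ℕ) [ExpChar R p] {Δ : QWeilDivisor R} (hΔ : 0 ≤ Δ) (N : Submodule R M) :
    Submodule R M where
  carrier := {z | ∃ c : R, c ≠ 0 ∧ ∀ᶠ e : ℕ in Filter.atTop,
    z ⊗ₜ[R] root K p e hΔ c ∈ frobeniusImage K p e Δ N}
  zero_mem' := ⟨1, one_ne_zero, Filter.Eventually.of_forall fun e => by
    rw [TensorProduct.zero_tmul]; exact Submodule.zero_mem _⟩
  add_mem' := by
    rintro x y ⟨c, hc, hx⟩ ⟨d, hd, hy⟩
    refine ⟨c * d, mul_ne_zero hc hd, ?_⟩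
    filter_upwards [hx, hy] with e hxe hye
    rw [TensorProduct.add_tmul]
    refine Submodule.add_mem _ ?_ (tmul_root_mul_mem K p e hΔ N y d c hye)
    rw [mul_comm c d]
    exact tmul_root_mul_mem K p e hΔ N x c d hxe
  smul_mem' := by
    rintro r x ⟨c, hc, hx⟩
    refine ⟨c, hc, ?_⟩
    filter_upwards [hx] with e hxe
    rw [← TensorProduct.smul_tmul']
    exact Submodule.smul_mem _ r hxe

end Divisors

end FPairs

end

noncomputable section

namespace FPairs

/-! ### Orders of vanishing and height-one primes -/

/-! Write q = p^e. Splitting at c means that some R-linear φ : R((q-1)Δ)^{1/q} → R has φ(c^{1/q}) =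
1 (`isStronglyFRegular_iff`).

If z ⊗ c^{1/q} = 0 in E ⊗ R((q-1)Δ)^{1/q} for all large q, then applying id ⊗ φ gives z = 0,
provided a splitting exists for some large e. `IsStronglyFRegular.exists_ge` supplies it by
composing splittings: a form at e₁ extends to sections of the larger divisor after multiplication by
some d vanishing along Δ (`exists_extension`), and a splitting at e₂ for d finishes.

Conversely, suppose c splits for no e. By F-finiteness and normality the twists are finite modules,
so `IsInjectiveHull.exists_apply_eq_one` applies: R → M, 1 ↦ m, splits unless m kills the socle of
E. Hence ι 1 ⊗ c^{1/q} = 0 for every q, and ι 1 is a nonzero element of the tight closure of zero.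
-/

theorem PrimeDivisor.eq_of_le {R : Type u} [CommRing R] [IsNoetherianRing R]
    {P Q : PrimeDivisor R} (h : Q.asIdeal ≤ P.asIdeal) : Q = P := by
  refine PrimeDivisor.ext (by_contra fun hne => ?_)
  have hlt := Ideal.height_strict_mono_of_isPrime_of_isPrime (lt_of_le_of_ne h hne)
  rw [P.height_eq_one, Q.height_eq_one] at hlt
  exact lt_irrefl _ hlt

theorem PrimeDivisor.exists_ne_zero_mem {R : Type u} [CommRing R] [IsDomain R]
    (P : PrimeDivisor R) : ∃ r ∈ P.asIdeal, r ≠ 0 :=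
  Submodule.exists_mem_ne_zero_of_ne_bot (Ideal.ne_bot_of_height_eq_one P.height_eq_one)

section Ord

variable {R : Type u} [CommRing R] [IsDomain R] [IsNoetherianRing R] [IsIntegrallyClosed R]
  {K : Type w} [Field K] [Algebra R K] [IsFractionRing R K]

theorem PrimeDivisor.ord_eq_zero_of_notMem (P : PrimeDivisor R) {r : R} (hr : r ∉ P.asIdeal) :
    P.ord (algebraMap R K r) = 0 := by
  have h : P.valuation (algebraMap R K r) = 1 := by
    rw [PrimeDivisor.valuation, IsScalarTower.algebraMap_apply R (P.localRing K) K]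
    refine (IsDedekindDomain.HeightOneSpectrum.valuation_eq_one_iff_notMem _).mpr ?_
    exact fun h => hr ((IsLocalization.AtPrime.to_map_mem_maximal_iff _ P.asIdeal r).mp h)
  rw [PrimeDivisor.ord, h, WithZero.log_one, neg_zero]

theorem PrimeDivisor.one_le_ord_of_mem (P : PrimeDivisor R) {r : R} (hr : r ∈ P.asIdeal)
    (hr0 : r ≠ 0) : 1 ≤ P.ord (algebraMap R K r) := by
  have h : P.valuation (algebraMap R K r) < 1 := by
    rw [PrimeDivisor.valuation, IsScalarTower.algebraMap_apply R (P.localRing K) K]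
    refine (IsDedekindDomain.HeightOneSpectrum.valuation_lt_one_iff_mem _ _).mpr ?_
    exact (IsLocalization.AtPrime.to_map_mem_maximal_iff _ P.asIdeal r).mpr hr
  have h0 : P.valuation (algebraMap R K r) ≠ 0 :=
    (Valuation.ne_zero_iff _).mpr ((map_ne_zero_iff _ (IsFractionRing.injective R K)).mpr hr0)
  have := (WithZero.log_lt_log h0 one_ne_zero).mpr h
  rw [WithZero.log_one] at this
  rw [PrimeDivisor.ord]
  omega

theorem PrimeDivisor.ord_pow (P : PrimeDivisor R) (x : K) (n : ℕ) :
    P.ord (x ^ n) = n * P.ord x := by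
  simp [PrimeDivisor.ord, WithZero.log_pow]

/-- An element of `K` of nonnegative order along `P` is a fraction with denominator prime
to `P`. -/
theorem PrimeDivisor.exists_eq_div (P : PrimeDivisor R) {x : K} (hx : x ≠ 0) (h : 0 ≤ P.ord x) :
    ∃ r s : R, s ∉ P.asIdeal ∧ algebraMap R K s * x = algebraMap R K r := by
  have h0 : P.valuation x ≠ 0 := (Valuation.ne_zero_iff _).mpr hx
  have h1 : P.valuation x ≤ 1 := by
    refine (WithZero.log_le_log h0 one_ne_zero).mp ?_
    rw [WithZero.log_one]
    rw [PrimeDivisor.ord] at h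
    omega
  obtain ⟨y, rfl⟩ := IsDiscreteValuationRing.exists_lift_of_le_one h1
  obtain ⟨⟨r, s⟩, hrs⟩ := IsLocalization.surj P.asIdeal.primeCompl y
  refine ⟨r, s, s.2, ?_⟩
  rw [IsScalarTower.algebraMap_apply R (P.localRing K) K,
    IsScalarTower.algebraMap_apply R (P.localRing K) K r, ← hrs, map_mul, mul_comm]

variable (K) in
theorem PrimeDivisor.exists_ord_eq_one (P : PrimeDivisor R) :
    ∃ r : R, r ≠ 0 ∧ P.ord (algebraMap R K r) = 1 := by
  obtain ⟨x, hx⟩ := (IsDiscreteValuationRing.maximalIdeal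
    (P.localRing K)).valuation_exists_uniformizer K
  have hv : P.ord x = 1 := by
    rw [PrimeDivisor.ord, PrimeDivisor.valuation, hx, WithZero.log_exp, neg_neg]
  have hx0 : x ≠ 0 := by
    rintro rfl
    rw [map_zero] at hx
    exact WithZero.exp_ne_zero hx.symm
  obtain ⟨r, s, hs, hrs⟩ := P.exists_eq_div hx0 (by omega)
  have hs0 : s ≠ 0 := fun h => hs (h ▸ P.asIdeal.zero_mem)
  have hs0' : algebraMap R K s ≠ 0 := (map_ne_zero_iff _ (IsFractionRing.injective R K)).mpr hs0
  refine ⟨r, ?_, ?_⟩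
  · rintro rfl
    rw [map_zero] at hrs
    exact mul_ne_zero hs0' hx0 hrs
  · rw [← hrs, P.ord_mul hs0' hx0, P.ord_eq_zero_of_notMem hs, hv, zero_add]

variable (K) in
/-- Elements vanishing along finitely many given prime divisors. -/
theorem exists_one_le_ord (S : Finset (PrimeDivisor R)) :
    ∃ d : R, d ≠ 0 ∧ ∀ P ∈ S, 1 ≤ P.ord (algebraMap R K d) := by
  choose f hf hf0 using fun P : PrimeDivisor R => P.exists_ne_zero_mem
  have h0 : ∏ P ∈ S, f P ≠ 0 := Finset.prod_ne_zero_iff.mpr fun P _ => hf0 P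
  exact ⟨_, h0, fun P hP =>
    P.one_le_ord_of_mem (Ideal.mem_of_dvd _ (Finset.dvd_prod_of_mem f hP) (hf P)) h0⟩

variable (K) in
/-- Elements of prescribed order along one prime divisor, and of large order along finitely
many others. -/
theorem PrimeDivisor.exists_ord_eq (P : PrimeDivisor R) (S : Finset (PrimeDivisor R)) (n N : ℕ) :
    ∃ t : R, t ≠ 0 ∧ P.ord (algebraMap R K t) = n ∧
      ∀ Q ∈ S, Q ≠ P → (N : ℤ) ≤ Q.ord (algebraMap R K t) := by
  classical
  -- Distinct height-one primes are incomparable.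
  have hex : ∀ Q : PrimeDivisor R, ∃ r : R, r ∉ P.asIdeal ∧ (Q ≠ P → r ∈ Q.asIdeal) := by
    intro Q
    by_cases h : Q = P
    · exact ⟨1, P.isPrime.one_notMem, fun h' => (h' h).elim⟩
    · obtain ⟨r, hr, hr'⟩ := SetLike.not_le_iff_exists.mp fun hle => h (PrimeDivisor.eq_of_le hle)
      exact ⟨r, hr', fun _ => hr⟩
  choose f hf hf' using hex
  obtain ⟨a, ha0, ha⟩ := P.exists_ord_eq_one K
  set s := ∏ Q ∈ S, f Q with hs
  have hsP : s ∉ P.asIdeal := by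
    rw [hs, Ideal.IsPrime.prod_mem_iff]
    rintro ⟨Q, _, hQ⟩
    exact hf Q hQ
  have hs0 : s ≠ 0 := fun h => hsP (h ▸ P.asIdeal.zero_mem)
  have inj := IsFractionRing.injective R K
  have ha0' : algebraMap R K a ≠ 0 := (map_ne_zero_iff _ inj).mpr ha0
  have hs0' : algebraMap R K s ≠ 0 := (map_ne_zero_iff _ inj).mpr hs0
  refine ⟨a ^ n * s ^ N, mul_ne_zero (pow_ne_zero _ ha0) (pow_ne_zero _ hs0), ?_, ?_⟩
  · rw [map_mul, map_pow, map_pow, P.ord_mul (pow_ne_zero _ ha0') (pow_ne_zero _ hs0'),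
      P.ord_pow, P.ord_pow, ha, P.ord_eq_zero_of_notMem hsP]
    ring
  · intro Q hQ hQP
    have h1 : 1 ≤ Q.ord (algebraMap R K s) := Q.one_le_ord_of_mem
      (Ideal.mem_of_dvd _ (Finset.dvd_prod_of_mem f hQ) (hf' Q hQP)) hs0
    have h2 : 0 ≤ Q.ord (algebraMap R K a) := Q.ord_algebraMap_nonneg ha0
    rw [map_mul, map_pow, map_pow, Q.ord_mul (pow_ne_zero _ ha0') (pow_ne_zero _ hs0'),
      Q.ord_pow, Q.ord_pow]
    have h3 : 0 ≤ (n : ℤ) * Q.ord (algebraMap R K a) := by positivity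
    have h4 : (N : ℤ) * 1 ≤ N * Q.ord (algebraMap R K s) :=
      mul_le_mul_of_nonneg_left h1 (by positivity)
    linarith

/-- In a normal Noetherian domain, a prime `(b : y)` with `y ∉ (b)` has height one. -/
theorem height_eq_one_of_mem_iff {P : Ideal R} [P.IsPrime] {b y : R} (hb : b ≠ 0)
    (hP : ∀ r, r ∈ P ↔ b ∣ r * y) : P.height = 1 := by
  have hby : ¬ b ∣ y := fun h => Ideal.IsPrime.one_notMem ‹P.IsPrime› ((hP 1).mpr (by simpa using h))
  have hbP : b ∈ P := (hP b).mpr (Dvd.intro _ rfl)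
  have hPbot : P ≠ ⊥ := fun h => hb (by simpa [h] using hbP)
  let F := FractionRing R
  have inj := IsFractionRing.injective R F
  have hbF : algebraMap R F b ≠ 0 := (map_ne_zero_iff _ inj).mpr hb
  -- Otherwise y/b maps the finite module P into itself, so it is integral over R and lies in R by
  -- normality, contradicting b ∤ y.
  obtain ⟨q, hq, t, ht, hqt⟩ : ∃ q ∈ P, ∃ t, t ∉ P ∧ q * y = b * t := by
    by_contra! hcon
    apply hby
    let N : Submodule R F := Submodule.map (Algebra.linearMap R F) P
    have hint : IsIntegral R (algebraMap R F y / algebraMap R F b) := by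
      refine isIntegral_of_smul_mem_submodule N ?_ ?_ _ ?_
      · intro h
        refine hPbot (Submodule.map_injective_of_injective (f := Algebra.linearMap R F) inj ?_)
        rw [Submodule.map_bot]
        exact h
      · exact Submodule.FG.map _ (IsNoetherian.noetherian P)
      · rintro _ ⟨r, hr, rfl⟩
        obtain ⟨t, ht⟩ := (hP r).mp hr
        refine ⟨t, by_contra fun h => hcon r hr t h ht, ?_⟩
        rw [Algebra.linearMap_apply, Algebra.linearMap_apply, smul_eq_mul, div_mul_eq_mul_div,
          eq_div_iff hbF, ← map_mul, ← map_mul]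
        congr 1
        rw [mul_comm t, ← ht, mul_comm]
    obtain ⟨z, hz⟩ := IsIntegrallyClosed.isIntegral_iff.mp hint
    rw [eq_div_iff hbF, ← map_mul] at hz
    exact ⟨z, by rw [← inj hz, mul_comm]⟩
  refine le_antisymm ?_ (Order.one_le_iff_ne_zero.mpr fun h =>
    hPbot (Ideal.height_eq_zero_iff_eq_bot.mp h))
  -- Krull's principal ideal theorem: q generates P once t is inverted, so P is minimal over (q).
  refine Ideal.height_le_one_of_isPrincipal_of_mem_minimalPrimes (Ideal.span {q}) P
    ⟨⟨inferInstance, (Ideal.span_singleton_le_iff_mem _).mpr hq⟩, ?_⟩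
  rintro Q ⟨hQ, hqQ⟩ hQP r hr
  obtain ⟨s, hs⟩ := (hP r).mp hr
  have hmul : r * t = q * s := by
    apply mul_left_cancel₀ hb
    linear_combination (-r) * hqt + q * hs
  have : r * t ∈ Q := by
    rw [hmul]
    exact Q.mul_mem_right _ ((Ideal.span_singleton_le_iff_mem _).mp hqQ)
  exact (hQ.mem_or_mem this).resolve_right fun h => ht (hQP h)

/-- A normal Noetherian domain is the intersection of its localizations at height-one primes. -/
theorem exists_algebraMap_eq_of_ord_nonneg {x : K} (hx : x ≠ 0)
    (h : ∀ P : PrimeDivisor R, 0 ≤ P.ord x) : ∃ r : R, algebraMap R K r = x := by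
  obtain ⟨a, b, hb, rfl⟩ := IsFractionRing.div_surjective (A := R) x
  have hb0 : b ≠ 0 := nonZeroDivisors.ne_zero hb
  have inj := IsFractionRing.injective R K
  have hbK : algebraMap R K b ≠ 0 := (map_ne_zero_iff _ inj).mpr hb0
  by_contra hcon
  have hba : (Ideal.Quotient.mk (Ideal.span {b}) a : R ⧸ Ideal.span {b}) ≠ 0 := by
    intro h0
    rw [Ideal.Quotient.eq_zero_iff_mem, Ideal.mem_span_singleton] at h0
    obtain ⟨c, rfl⟩ := h0
    exact hcon ⟨c, by rw [map_mul, mul_div_cancel_left₀ _ hbK]⟩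
  -- An associated prime P = (b : y) of R/(b) containing (b : a). It has height one, so a/b has a
  -- denominator s ∉ P; but s ∈ (b : a) ⊆ P.
  obtain ⟨P, hP, hle⟩ := exists_le_isAssociatedPrime_of_isNoetherianRing R _ hba
  rw [isAssociatedPrime_iff] at hP
  obtain ⟨hPp, z, hz⟩ := hP
  obtain ⟨y, rfl⟩ := Ideal.Quotient.mk_surjective z
  have hcol : ∀ y r : R, r ∈ (⊥ : Submodule R (R ⧸ Ideal.span {b})).colon
      {Ideal.Quotient.mk (Ideal.span {b}) y} ↔ b ∣ r * y := by
    intro y r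
    rw [Submodule.mem_colon_singleton, Submodule.mem_bot, Algebra.smul_def,
      Ideal.Quotient.algebraMap_eq, ← map_mul, Ideal.Quotient.eq_zero_iff_mem,
      Ideal.mem_span_singleton]
  have hht : P.height = 1 := height_eq_one_of_mem_iff hb0 fun r => by rw [hz, hcol]
  let PD : PrimeDivisor R := ⟨P, hPp, hht⟩
  obtain ⟨r, s, hs, hrs⟩ := PD.exists_eq_div hx (h PD)
  refine hs (hle ((hcol a s).mpr ⟨r, inj ?_⟩))
  rw [mul_div_assoc', div_eq_iff hbK] at hrs
  rw [map_mul, map_mul, hrs, mul_comm]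

variable (K) in
-- Take a high power of an element vanishing along the support. Such a d clears denominators, moving
-- R(D) into R.
theorem exists_le_ord (D : QWeilDivisor R) :
    ∃ d : R, d ≠ 0 ∧ ∀ P : PrimeDivisor R, D P ≤ (P.ord (algebraMap R K d) : ℚ) := by
  obtain ⟨d, hd0, hd⟩ := exists_one_le_ord K D.support
  obtain ⟨N, hN⟩ : ∃ N : ℕ, ∀ P ∈ D.support, D P ≤ N := by
    refine ⟨∑ P ∈ D.support, ⌈D P⌉₊, fun P hP => (Nat.le_ceil _).trans ?_⟩
    exact_mod_cast Finset.single_le_sum (f := fun P => ⌈D P⌉₊) (fun _ _ => Nat.zero_le _) hP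
  refine ⟨d ^ N, pow_ne_zero _ hd0, fun P => ?_⟩
  by_cases hP : P ∈ D.support
  · rw [map_pow, P.ord_pow]
    have : (1 : ℚ) ≤ P.ord (algebraMap R K d) := by exact_mod_cast hd P hP
    push_cast
    exact (hN P hP).trans (le_mul_of_one_le_right (Nat.cast_nonneg _) this)
  · rw [Finsupp.notMem_support_iff.mp hP]
    exact Int.cast_nonneg (P.ord_algebraMap_nonneg (pow_ne_zero _ hd0))

variable (K) in
/-- The module of sections of a `ℚ`-Weil divisor is isomorphic to an ideal, hence finite. -/
theorem finite_sections (D : QWeilDivisor R) : Module.Finite R (sections K D) := by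
  obtain ⟨d, hd0, hd⟩ := exists_le_ord K D
  have inj := IsFractionRing.injective R K
  have hdK : algebraMap R K d ≠ 0 := (map_ne_zero_iff _ inj).mpr hd0
  let f : sections K D →ₗ[R] K := LinearMap.lsmul R K d ∘ₗ (sections K D).subtype
  have hf : ∀ x, f x = algebraMap R K d * x := fun x => Algebra.smul_def _ _
  have hrange : ∀ x, f x ∈ LinearMap.range (Algebra.linearMap R K) := by
    intro x
    by_cases hx : (x : K) = 0
    · rw [hf, hx, mul_zero]
      exact Submodule.zero_mem _
    · rw [hf]
      refine exists_algebraMap_eq_of_ord_nonneg (mul_ne_zero hdK hx) fun P => ?_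
      have h1 := x.2 hx P
      have h2 := hd P
      rw [P.ord_mul hdK hx]
      have : (0 : ℚ) ≤ ((P.ord (algebraMap R K d) + P.ord (x : K) : ℤ) : ℚ) := by
        push_cast
        linarith
      exact_mod_cast this
  refine Module.Finite.of_injective (f.codRestrict _ hrange) fun x y hxy => ?_
  have : f x = f y := congrArg Subtype.val hxy
  rw [hf, hf] at this
  exact Subtype.ext (mul_left_cancel₀ hdK this)

end Ord

/-! ### Purity and splitting -/

section Purity

variable {R : Type u} [CommRing R]

/-- If `N → N ⊗ M`, `n ↦ n ⊗ m`, is injective for every `N`, and `M` is finitely presented, then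
`R → M`, `r ↦ r • m` splits. -/
theorem exists_apply_eq_one_of_pure [IsNoetherianRing R] {M : Type w} [AddCommGroup M] [Module R M]
    [Module.Finite R M] (m : M)
    (hm : ∀ (N : Type u) [AddCommGroup N] [Module R N] (n : N), n ⊗ₜ[R] m = 0 → n = 0) :
    ∃ g : M →ₗ[R] R, g m = 1 := by
  obtain ⟨n, π, hπ⟩ := Module.Finite.exists_fin' R M
  -- Generators (a j, b j) of the relations between m and generators of M. A form with value 1 at m
  -- amounts to a solution s of the linear system A s = b.
  let C : Submodule R ((Fin n → R) × R) := LinearMap.ker (π.coprod (LinearMap.toSpanSingleton R M m))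
  obtain ⟨k, ρ, hρ⟩ := Module.Finite.exists_fin' R C
  let a : Fin k → Fin n → R := fun j => (ρ (Pi.single j 1) : (Fin n → R) × R).1
  let b : Fin k → R := fun j => (ρ (Pi.single j 1) : (Fin n → R) × R).2
  have hrel : ∀ j, π (a j) + b j • m = 0 := fun j => by
    have h := LinearMap.mem_ker.mp (ρ (Pi.single j 1)).2
    rwa [LinearMap.coprod_apply, LinearMap.toSpanSingleton_apply] at h
  have hπa : ∀ v : Fin n → R, π v = ∑ i, v i • π (Pi.single i 1) := fun v => by
    conv_lhs => rw [pi_eq_sum_univ' v]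
    simp [map_sum, map_smul]
  let A : (Fin n → R) →ₗ[R] (Fin k → R) := Matrix.mulVecLin (Matrix.of a)
  have hA : ∀ v j, A v j = ∑ i, a j i * v i := fun v j => rfl
  -- Purity is tested on coker A: the relations rewrite b ⊗ m as a combination of columns of A
  -- tensored with generators of M, and these columns vanish in the cokernel.
  have hb : b ∈ LinearMap.range A := by
    rw [← Submodule.Quotient.mk_eq_zero]
    refine hm _ _ ?_
    have hbsum : b = ∑ j, b j • (Pi.single j 1 : Fin k → R) := pi_eq_sum_univ' b
    have hcol : ∀ i, ∑ j, a j i • (LinearMap.range A).mkQ (Pi.single j 1 : Fin k → R) = 0 := by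
      intro i
      rw [← map_zero (LinearMap.range A).mkQ]
      simp_rw [← map_smul, ← map_sum]
      rw [map_zero, Submodule.mkQ_apply, Submodule.Quotient.mk_eq_zero]
      refine ⟨Pi.single i 1, ?_⟩
      ext j
      rw [hA]
      simp [Pi.single_apply]
    calc (LinearMap.range A).mkQ b ⊗ₜ[R] m
        = ∑ j, (LinearMap.range A).mkQ (Pi.single j 1 : Fin k → R) ⊗ₜ[R] (b j • m) := by
          conv_lhs => rw [hbsum]
          simp only [map_sum, map_smul, TensorProduct.sum_tmul, TensorProduct.smul_tmul]
      _ = -∑ j, (LinearMap.range A).mkQ (Pi.single j 1 : Fin k → R) ⊗ₜ[R]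
            ∑ i, a j i • π (Pi.single i 1) := by
          rw [← Finset.sum_neg_distrib]
          refine Finset.sum_congr rfl fun j _ => ?_
          rw [← hπa, eq_neg_of_add_eq_zero_right (hrel j), TensorProduct.tmul_neg]
      _ = -∑ i, (∑ j, a j i • (LinearMap.range A).mkQ (Pi.single j 1 : Fin k → R)) ⊗ₜ[R]
            π (Pi.single i 1) := by
          simp only [TensorProduct.tmul_sum, TensorProduct.sum_tmul, TensorProduct.smul_tmul]
          rw [Finset.sum_comm]
      _ = 0 := by simp only [hcol, TensorProduct.zero_tmul, Finset.sum_const_zero, neg_zero]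
  obtain ⟨s, hs⟩ := hb
  -- The form (v, r) ↦ r - s·v kills every relation, so it descends to M; m is the class of (0, 1).
  let ℓ : ((Fin n → R) × R) →ₗ[R] R :=
    (-(∑ i, s i • LinearMap.proj (R := R) (φ := fun _ : Fin n => R) i)).coprod LinearMap.id
  have hℓ : ∀ v r, ℓ (v, r) = -(∑ i, s i * v i) + r := fun v r => by
    simp [ℓ, LinearMap.sum_apply]
  have hker : C ≤ LinearMap.ker ℓ := by
    have h0 : ℓ ∘ₗ C.subtype ∘ₗ ρ = 0 := by
      refine (Pi.basisFun R (Fin k)).ext fun j => ?_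
      rw [Pi.basisFun_apply]
      change ℓ (a j, b j) = 0
      rw [hℓ, ← hs, hA]
      simp [mul_comm]
    intro c hc
    obtain ⟨v, hv⟩ := hρ ⟨c, hc⟩
    have := LinearMap.congr_fun h0 v
    simpa [hv] using this
  let Ψ := π.coprod (LinearMap.toSpanSingleton R M m)
  have hΨ : Function.Surjective Ψ := fun x => by
    obtain ⟨v, rfl⟩ := hπ x
    exact ⟨(v, 0), by simp [Ψ]⟩
  refine ⟨C.liftQ ℓ hker ∘ₗ (Ψ.quotKerEquivOfSurjective hΨ).symm, ?_⟩
  have hm1 : m = Ψ (0, 1) := by simp [Ψ]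
  have : (Ψ.quotKerEquivOfSurjective hΨ).symm m = Submodule.Quotient.mk (0, 1) := by
    rw [LinearEquiv.symm_apply_eq, LinearMap.quotKerEquivOfSurjective_apply_mk]
    exact hm1
  rw [LinearMap.comp_apply, LinearEquiv.coe_coe, this]
  change C.liftQ ℓ hker (C.mkQ (0, 1)) = 1
  rw [Submodule.mkQ_apply, Submodule.liftQ_apply, hℓ]
  simp

/-- Elements of a module over a local ring are detected by maps to the injective hull of the
residue field. -/
theorem IsInjectiveHull.exists_apply_ne_zero [IsLocalRing R] {E : Type u} [AddCommGroup E]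
    [Module R E] {ι : IsLocalRing.ResidueField R →ₗ[R] E} (hι : IsInjectiveHull ι)
    {N : Type v} [AddCommGroup N] [Module R N] {n : N} (hn : n ≠ 0) :
    ∃ f : N →ₗ[R] E, f n ≠ 0 := by
  have := hι.injective_module
  let t := LinearMap.toSpanSingleton R N n
  have hle : LinearMap.ker t ≤ IsLocalRing.maximalIdeal R := by
    refine IsLocalRing.le_maximalIdeal fun h => hn ?_
    have h1 : (1 : R) ∈ LinearMap.ker t := h ▸ Submodule.mem_top
    simpa [t] using h1
  -- The cyclic module Rn ≅ R/ann n surjects onto the residue field, which embeds in E; injectivity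
  -- extends this map to N.
  let g : R ⧸ LinearMap.ker t →ₗ[R] E :=
    (LinearMap.ker t).liftQ (ι ∘ₗ Algebra.linearMap R (IsLocalRing.ResidueField R)) fun r hr => by
      rw [LinearMap.mem_ker, LinearMap.comp_apply, Algebra.linearMap_apply]
      have : algebraMap R (IsLocalRing.ResidueField R) r = 0 :=
        (IsLocalRing.residue_eq_zero_iff r).mpr (hle hr)
      rw [this, map_zero]
  obtain ⟨f, hf⟩ := Module.Injective.extension_property R E _ _
    ((LinearMap.ker t).liftQ t le_rfl) (LinearMap.ker_eq_bot.mp (Submodule.ker_liftQ_eq_bot' _ _ rfl)) g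
  refine ⟨f, fun h0 => ?_⟩
  have h1 := LinearMap.congr_fun hf ((LinearMap.ker t).mkQ 1)
  rw [LinearMap.comp_apply, Submodule.mkQ_apply, Submodule.liftQ_apply, Submodule.liftQ_apply,
    LinearMap.toSpanSingleton_apply, one_smul, h0, LinearMap.comp_apply, Algebra.linearMap_apply,
    map_one] at h1
  exact one_ne_zero (hι.injective_map (h1.symm.trans (map_zero ι).symm))

/-- The splitting criterion: if the socle of the injective hull `E` of the residue field is not
killed in `E ⊗ M` by `m`, then `r ↦ r • m` splits. -/
theorem IsInjectiveHull.exists_apply_eq_one [IsNoetherianRing R] [IsLocalRing R] {E : Type u}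
    [AddCommGroup E] [Module R E] {ι : IsLocalRing.ResidueField R →ₗ[R] E}
    (hι : IsInjectiveHull ι) {M : Type w} [AddCommGroup M] [Module R M] [Module.Finite R M]
    (m : M) (hm : ι 1 ⊗ₜ[R] m ≠ 0) : ∃ g : M →ₗ[R] R, g m = 1 := by
  let φ : E →ₗ[R] E ⊗[R] M := (TensorProduct.mk R E M).flip m
  have hφ : ∀ z, φ z = z ⊗ₜ m := fun z => rfl
  have hinj : LinearMap.ker φ = ⊥ := by
    by_contra hne
    -- By essentiality a nonzero kernel meets the image of the residue field, hence contains ι 1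
    -- after scaling.
    obtain ⟨z, ⟨hz, ⟨x, rfl⟩⟩, hz0⟩ :=
      Submodule.exists_mem_ne_zero_of_ne_bot (hι.essential _ hne)
    have hx : x ≠ 0 := fun h => hz0 (by rw [h, map_zero])
    obtain ⟨r, hr⟩ := IsLocalRing.residue_surjective x⁻¹
    have : r • x = 1 := by
      rw [Algebra.smul_def]
      change IsLocalRing.residue R r * x = 1
      rw [hr, inv_mul_cancel₀ hx]
    apply hm
    have h := (LinearMap.ker φ).smul_mem r hz
    rwa [← map_smul, this, LinearMap.mem_ker] at h
  refine exists_apply_eq_one_of_pure m fun N _ _ n hn => by_contra fun hn0 => ?_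
  obtain ⟨f, hf⟩ := hι.exists_apply_ne_zero hn0
  refine hf (LinearMap.ker_eq_bot'.mp hinj _ ?_)
  rw [hφ, ← LinearMap.rTensor_tmul, hn, map_zero]

end Purity

/-! ### Maps to `R` from Frobenius pushforwards of sections -/

section Twist

variable {R : Type u} [CommRing R] [IsDomain R] [IsNoetherianRing R] [IsIntegrallyClosed R]
  {K : Type w} [Field K] [Algebra R K] [IsFractionRing R K]

variable (K) in
/-- An effective divisor is dominated by the divisor of some `t`, up to rounding sharply so
along a given `P`. -/
theorem PrimeDivisor.exists_ord_eq_ceil {D : QWeilDivisor R} (P : PrimeDivisor R) :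
    ∃ t : R, t ≠ 0 ∧ P.ord (algebraMap R K t) = ⌈D P⌉₊ ∧
      ∀ Q : PrimeDivisor R, D Q ≤ (Q.ord (algebraMap R K t) : ℚ) := by
  obtain ⟨N, hN⟩ : ∃ N : ℕ, ∀ P ∈ D.support, D P ≤ N := by
    refine ⟨∑ P ∈ D.support, ⌈D P⌉₊, fun P hP => (Nat.le_ceil _).trans ?_⟩
    exact_mod_cast Finset.single_le_sum (f := fun P => ⌈D P⌉₊) (fun _ _ => Nat.zero_le _) hP
  obtain ⟨t, ht0, htP, ht⟩ := P.exists_ord_eq K D.support ⌈D P⌉₊ N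
  refine ⟨t, ht0, htP, fun Q => ?_⟩
  by_cases hQP : Q = P
  · subst hQP
    rw [htP]
    exact_mod_cast Nat.le_ceil (D Q)
  by_cases hQ : Q ∈ D.support
  · exact (hN Q hQ).trans (by exact_mod_cast ht Q hQ hQP)
  · rw [Finsupp.notMem_support_iff.mp hQ]
    exact Int.cast_nonneg (Q.ord_algebraMap_nonneg ht0)

/-- If `div t ≥ D'`, then multiplication by `t ^ q` maps `R(D + q D')` to `R(D)`. -/
theorem pow_smul_mem_sections {D D' : QWeilDivisor R} {q : ℕ} {t : R}
    (ht : ∀ P : PrimeDivisor R, D' P ≤ (P.ord (algebraMap R K t) : ℚ)) {x : K}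
    (hx : x ∈ sections K (D + (q : ℚ) • D')) : t ^ q • x ∈ sections K D := by
  intro h0 P
  rw [Algebra.smul_def] at h0 ⊢
  have hx0 : x ≠ 0 := right_ne_zero_of_mul h0
  have h1 := hx hx0 P
  rw [Finsupp.add_apply, Finsupp.smul_apply, smul_eq_mul] at h1
  rw [P.ord_mul (left_ne_zero_of_mul h0) hx0, map_pow, P.ord_pow]
  have h2 := mul_le_mul_of_nonneg_left (ht P) (Nat.cast_nonneg q : (0 : ℚ) ≤ q)
  push_cast
  linarith

/-- A map `ᵉR(D) → R`, after multiplication by a `d` vanishing along the support of `D'`, extends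
to `R(D + q D') → R(D')`. -/
theorem exists_extension {p : ℕ} [ExpChar R p] {e : ℕ} {D D' : QWeilDivisor R} (hD' : 0 ≤ D')
    (φ : FrobeniusPushforward p e (sections K D) →ₗ[R] R) {d : R} (hd0 : d ≠ 0)
    (hd : ∀ P ∈ D'.support, 1 ≤ P.ord (algebraMap R K d)) :
    ∃ ψ : sections K (D + ((p ^ e : ℕ) : ℚ) • D') →+ sections K D',
      (∀ (r : R) x, ψ (r ^ p ^ e • x) = r • ψ x) ∧
      ∀ (x : sections K D) (x' : sections K (D + ((p ^ e : ℕ) : ℚ) • D')), (x : K) = x' →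
        (ψ x' : K) = algebraMap R K (d * φ (FrobeniusPushforward.of p e x)) := by
  have inj := IsFractionRing.injective R K
  have hdK : algebraMap R K d ≠ 0 := (map_ne_zero_iff _ inj).mpr hd0
  have hφ : ∀ (r : R) (x : sections K D), φ (FrobeniusPushforward.of p e (r ^ p ^ e • x)) =
      r * φ (FrobeniusPushforward.of p e x) := fun r x =>
    φ.map_smul r (FrobeniusPushforward.of p e x)
  obtain ⟨b, hb0, hb⟩ := exists_le_ord K D'
  have hbK : algebraMap R K b ≠ 0 := (map_ne_zero_iff _ inj).mpr hb0
  -- With div b ≥ D', the extension of φ to x must be φ(b^q x)/b; G is its numerator and ψ will be d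
  -- G / b.
  let G : sections K (D + ((p ^ e : ℕ) : ℚ) • D') → R := fun x =>
    φ (FrobeniusPushforward.of p e ⟨b ^ p ^ e • (x : K), pow_smul_mem_sections hb x.2⟩)
  have hGadd : ∀ x y, G (x + y) = G x + G y := fun x y => by
    rw [← map_add]
    exact congrArg φ (Subtype.ext (smul_add _ _ _))
  have hGsmul : ∀ r x, G (r ^ p ^ e • x) = r * G x := fun r x => by
    rw [← hφ]
    exact congrArg (fun z => φ (FrobeniusPushforward.of p e z)) (Subtype.ext (smul_comm _ _ _))
  -- The quotient φ(t^q x)/t does not depend on t, so a different t may be used to bound the order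
  -- along each P.
  have hG : ∀ (x : sections K (D + ((p ^ e : ℕ) : ℚ) • D')) (t : R) (ht : t ^ p ^ e • (x : K) ∈ sections K D),
      t * G x = b * φ (FrobeniusPushforward.of p e ⟨t ^ p ^ e • (x : K), ht⟩) := fun x t ht => by
    rw [← hφ, ← hφ]
    exact congrArg (fun z => φ (FrobeniusPushforward.of p e z)) (Subtype.ext (smul_comm _ _ _))
  have hmem : ∀ x, algebraMap R K (d * G x) / algebraMap R K b ∈ sections K D' := by
    intro x h0 P
    obtain ⟨t, ht0, htP, ht⟩ := P.exists_ord_eq_ceil (D := D') K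
    have htK : algebraMap R K t ≠ 0 := (map_ne_zero_iff _ inj).mpr ht0
    set s := φ (FrobeniusPushforward.of p e
      ⟨t ^ p ^ e • (x : K), pow_smul_mem_sections ht x.2⟩) with hs
    have hts : t * G x = b * s := hG x t (pow_smul_mem_sections ht x.2)
    have heq : algebraMap R K t * (algebraMap R K (d * G x) / algebraMap R K b) =
        algebraMap R K d * algebraMap R K s := by
      rw [mul_div_assoc', div_eq_iff hbK, ← map_mul, ← map_mul, ← map_mul]
      congr 1
      linear_combination d * hts
    have hsK : algebraMap R K s ≠ 0 := by
      intro h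
      rw [h, mul_zero] at heq
      exact mul_ne_zero htK h0 heq
    have hs0 : s ≠ 0 := fun h => hsK (by rw [h, map_zero])
    have hord := congrArg P.ord heq
    rw [P.ord_mul htK h0, P.ord_mul hdK hsK, htP] at hord
    have hs1 := P.ord_algebraMap_nonneg (K := K) hs0
    have hord' : (P.ord (algebraMap R K d) : ℚ) - ⌈D' P⌉₊ ≤
        P.ord (algebraMap R K (d * G x) / algebraMap R K b) := by
      have : P.ord (algebraMap R K d) - (⌈D' P⌉₊ : ℤ) ≤
        P.ord (algebraMap R K (d * G x) / algebraMap R K b) := by omega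
      exact_mod_cast this
    -- Rounding D' up costs less than 1 along its support, which the vanishing of d repays; off the
    -- support nothing is lost.
    by_cases hP : P ∈ D'.support
    · have h1 : (1 : ℚ) ≤ P.ord (algebraMap R K d) := by exact_mod_cast hd P hP
      have h2 := Nat.ceil_lt_add_one (show 0 ≤ D' P from hD' P)
      linarith
    · have h1 : (0 : ℚ) ≤ P.ord (algebraMap R K d) :=
        Int.cast_nonneg (P.ord_algebraMap_nonneg hd0)
      rw [Finsupp.notMem_support_iff.mp hP] at hord' ⊢
      rw [Nat.ceil_zero, Nat.cast_zero] at hord'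
      linarith
  refine ⟨AddMonoidHom.mk' (fun x => ⟨_, hmem x⟩) fun x y => Subtype.ext ?_, fun r x =>
    Subtype.ext ?_, fun x x' h => ?_⟩
  · simp only [Submodule.coe_add, hGadd, mul_add, map_add, add_div]
  · simp only [AddMonoidHom.mk'_apply, Submodule.coe_smul, hGsmul, Algebra.smul_def, map_mul]
    ring
  · have hx' : (1 : R) ^ p ^ e • (x' : K) = x := by rw [one_pow, one_smul, h]
    have h1 : G x' = b * φ (FrobeniusPushforward.of p e x) := by
      rw [← one_mul (G x'), hG x' 1 (hx' ▸ x.2)]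
      exact congrArg (fun z => b * φ (FrobeniusPushforward.of p e z)) (Subtype.ext hx')
    change algebraMap R K (d * G x') / algebraMap R K b = _
    rw [h1, div_eq_iff hbK, ← map_mul]
    congr 1
    ring

/-- This is q₁q₂ - 1 = (q₁ - 1) + q₁(q₂ - 1). -/
theorem scaled_add {R : Type u} [CommRing R] (p e₁ e₂ : ℕ) (Δ : QWeilDivisor R) :
    scaled p (e₁ + e₂) Δ = scaled p e₁ Δ + ((p ^ e₁ : ℕ) : ℚ) • scaled p e₂ Δ := by
  rw [scaled, scaled, scaled, smul_smul, ← add_smul]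
  congr 1
  push_cast
  ring

/-- Since φ is 1 at the root of c, its extension by `exists_extension` sends c to d; following it
with a form that is 1 at the root of d gives the splitting. -/
theorem exists_apply_root_eq_one_add {p : ℕ} [ExpChar R p] {e₁ e₂ : ℕ} {Δ : QWeilDivisor R}
    (hΔ : 0 ≤ Δ) {c d : R} (hd0 : d ≠ 0) (hd : ∀ P ∈ Δ.support, 1 ≤ P.ord (algebraMap R K d))
    (hc : ∃ φ : FrobeniusTwist K p e₁ Δ →ₗ[R] R, φ (root K p e₁ hΔ c) = 1)
    (hdφ : ∃ φ : FrobeniusTwist K p e₂ Δ →ₗ[R] R, φ (root K p e₂ hΔ d) = 1) :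
    ∃ φ : FrobeniusTwist K p (e₁ + e₂) Δ →ₗ[R] R, φ (root K p (e₁ + e₂) hΔ c) = 1 := by
  obtain ⟨φ, hφ⟩ := hc
  obtain ⟨χ, hχ⟩ := hdφ
  obtain ⟨ψ, hψ, hψ'⟩ := exists_extension (scaled_nonneg p e₂ hΔ) φ hd0
    fun P hP => hd P (Finsupp.support_smul hP)
  let ι : sections K (scaled p (e₁ + e₂) Δ) →ₗ[R]
      sections K (scaled p e₁ Δ + ((p ^ e₁ : ℕ) : ℚ) • scaled p e₂ Δ) :=
    Submodule.inclusion (by rw [scaled_add])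
  have hsmul : ∀ (r : R) x, ψ (ι (r ^ p ^ (e₁ + e₂) • x)) = r ^ p ^ e₂ • ψ (ι x) := fun r x => by
    rw [← hψ, ← map_smul ι, ← pow_mul, ← pow_add, add_comm e₂]
  let Ψ : FrobeniusTwist K p (e₁ + e₂) Δ →ₗ[R] FrobeniusTwist K p e₂ Δ :=
    { toFun := fun x => FrobeniusPushforward.of p e₂ (ψ (ι x))
      map_add' := fun x y => congrArg (FrobeniusPushforward.of p e₂)
        ((congrArg ψ (ι.map_add x y)).trans (ψ.map_add _ _))
      map_smul' := fun r x => congrArg (FrobeniusPushforward.of p e₂) (hsmul r x) }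
  have hroot : ψ (ι (toSections K (scaled_nonneg p (e₁ + e₂) hΔ) c)) =
      toSections K (scaled_nonneg p e₂ hΔ) d := Subtype.ext <| by
    have h1 : φ (FrobeniusPushforward.of p e₁ (toSections K (scaled_nonneg p e₁ hΔ) c)) = 1 := hφ
    rw [hψ' (toSections K (scaled_nonneg p e₁ hΔ) c) _ rfl, h1, mul_one]
    rfl
  exact ⟨χ ∘ₗ Ψ, (congrArg (χ <| FrobeniusPushforward.of p e₂ ·) hroot).trans hχ⟩

theorem smul_root_eq_zero {p : ℕ} [ExpChar R p] {e : ℕ} {Δ : QWeilDivisor R} (hΔ : 0 ≤ Δ)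
    {c r : R} (hc : c ≠ 0) (h : r • root K p e hΔ c = 0) : r = 0 := by
  rw [root, FrobeniusPushforward.smul_of] at h
  have h' : algebraMap R K (r ^ p ^ e * c) = 0 := by
    have := congrArg (fun z : sections K (scaled p e Δ) => (z : K)) h
    rw [map_mul, ← Algebra.smul_def]
    exact this
  rw [map_eq_zero_iff _ (IsFractionRing.injective R K)] at h'
  exact eq_zero_of_pow_eq_zero ((mul_eq_zero.mp h').resolve_right hc)

/-- Strong `F`-regularity in terms of `R`-linear forms. -/
theorem isStronglyFRegular_iff {p : ℕ} [ExpChar R p] {Δ : QWeilDivisor R} (hΔ : 0 ≤ Δ) :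
    IsStronglyFRegular K p hΔ ↔ ∀ c : R, c ≠ 0 → ∃ e : ℕ,
      ∃ φ : FrobeniusTwist K p e Δ →ₗ[R] R, φ (root K p e hΔ c) = 1 := by
  refine forall₂_congr fun c hc => exists_congr fun e => ?_
  set x := root K p e hΔ c with hx
  have hinj : Function.Injective (LinearMap.toSpanSingleton R _ x) :=
    LinearMap.ker_eq_bot.mp (LinearMap.ker_eq_bot'.mpr fun r hr => smul_root_eq_zero hΔ hc hr)
  have hmem : x ∈ Submodule.span R {x} := Submodule.mem_span_singleton_self x
  constructor
  · rintro ⟨g, hg⟩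
    let ε : R ≃ₗ[R] Submodule.span R {x} :=
      LinearEquiv.ofInjective _ hinj ≪≫ₗ LinearEquiv.ofEq _ _ (LinearMap.range_toSpanSingleton x)
    refine ⟨ε.symm.toLinearMap ∘ₗ g, ?_⟩
    have h1 : g x = ⟨x, hmem⟩ := LinearMap.congr_fun hg ⟨x, hmem⟩
    rw [LinearMap.comp_apply, h1, LinearEquiv.coe_coe, LinearEquiv.symm_apply_eq]
    exact Subtype.ext (one_smul R x).symm
  · rintro ⟨φ, hφ⟩
    refine ⟨LinearMap.toSpanSingleton R _ ⟨x, hmem⟩ ∘ₗ φ, ?_⟩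
    ext ⟨y, hy⟩
    obtain ⟨r, rfl⟩ := Submodule.mem_span_singleton.mp hy
    simp [hφ]

theorem module_finite_compHom_of_finite {A B : Type*} [CommRing A] [CommRing B] {f : A →+* B}
    (hf : f.Finite) (M : Type*) [AddCommGroup M] [Module B M] [Module.Finite B M] :
    @Module.Finite A M _ _ (Module.compHom M f) := by
  let := f.toAlgebra
  let := Module.compHom M f
  have : Module.Finite A B := hf
  have : IsScalarTower A B M := ⟨fun a b m => mul_smul (f a) b m⟩
  exact Module.Finite.trans B M

theorem finite_iterateFrobenius {R : Type*} [CommRing R] {p : ℕ} [ExpChar R p]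
    (hF : (frobenius R p).Finite) (e : ℕ) : (iterateFrobenius R p e).Finite := by
  induction e with
  | zero =>
    rw [iterateFrobenius_zero]
    exact RingHom.Finite.id R
  | succ e ih =>
    have : iterateFrobenius R p (e + 1) = (frobenius R p).comp (iterateFrobenius R p e) := by
      ext x
      simp [iterateFrobenius_def, frobenius_def, pow_succ, pow_mul]
    rw [this]
    exact hF.comp ih

variable (K) in
-- F-finiteness enters the theorem only through this finiteness, which lets purity yield a
-- splitting.
theorem finite_frobeniusTwist {p : ℕ} [ExpChar R p] (hF : (frobenius R p).Finite) (e : ℕ)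
    (Δ : QWeilDivisor R) : Module.Finite R (FrobeniusTwist K p e Δ) :=
  have := finite_sections K (scaled p e Δ)
  module_finite_compHom_of_finite (finite_iterateFrobenius hF e) (sections K (scaled p e Δ))

theorem exists_apply_eq_one_of_isField {R : Type*} [CommRing R] (hR : IsField R) {M : Type*}
    [AddCommGroup M] [Module R M] {m : M} (hm : m ≠ 0) : ∃ φ : M →ₗ[R] R, φ m = 1 := by
  let := hR.toField
  exact Module.Projective.exists_dual_eq_one R hm

/-- For a strongly `F`-regular pair, splittings exist for arbitrarily large `e`. -/
theorem IsStronglyFRegular.exists_ge [IsLocalRing R] {p : ℕ} [ExpChar R p] {Δ : QWeilDivisor R}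
    {hΔ : 0 ≤ Δ} (h : IsStronglyFRegular K p hΔ) {c : R} (hc : c ≠ 0) (n : ℕ) :
    ∃ e ≥ n, ∃ φ : FrobeniusTwist K p e Δ →ₗ[R] R, φ (root K p e hΔ c) = 1 := by
  rw [isStronglyFRegular_iff] at h
  by_cases hR : IsField R
  -- A field has no nonzero nonunit to use below, but over it every e works.
  · refine ⟨n, le_rfl, exists_apply_eq_one_of_isField hR fun h0 => ?_⟩
    exact one_ne_zero (smul_root_eq_zero hΔ hc ((one_smul R _).trans h0))
  obtain ⟨a, ha, ha0⟩ := Submodule.exists_mem_ne_zero_of_ne_bot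
    (mt IsLocalRing.isField_iff_maximalIdeal_eq.mpr hR)
  obtain ⟨d, hd0, hd⟩ := exists_one_le_ord K Δ.support
  have had0 : a * d ≠ 0 := mul_ne_zero ha0 hd0
  have hle : ∀ P ∈ Δ.support, 1 ≤ P.ord (algebraMap R K (a * d)) := fun P hP => by
    have inj := IsFractionRing.injective R K
    rw [map_mul, P.ord_mul ((map_ne_zero_iff _ inj).mpr ha0) ((map_ne_zero_iff _ inj).mpr hd0)]
    have h1 := hd P hP
    have h2 := P.ord_algebraMap_nonneg (K := K) ha0
    omega
  obtain ⟨e', hφ⟩ := h _ had0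
  -- This is the purpose of the nonunit a: for e' = 0 the form would take a value in the maximal
  -- ideal. Each composition then raises e by at least 1.
  have he' : e' ≠ 0 := by
    rintro rfl
    obtain ⟨φ, hφ⟩ := hφ
    have hroot : root K p 0 hΔ (a * d) = a • root K p 0 hΔ d := by
      rw [root, root, FrobeniusPushforward.smul_of, pow_zero, pow_one, ← map_smul, smul_eq_mul]
    rw [hroot, map_smul, smul_eq_mul] at hφ
    exact (IsLocalRing.mem_maximalIdeal a).mp ha (IsUnit.of_mul_eq_one _ hφ)
  induction n with
  | zero =>
    obtain ⟨e, he⟩ := h c hc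
    exact ⟨e, Nat.zero_le e, he⟩
  | succ n ih =>
    obtain ⟨e, hen, he⟩ := ih
    exact ⟨e + e', by omega, exists_apply_root_eq_one_add hΔ had0 hle he hφ⟩

end Twist

end FPairs

end

/-! ### Splittings and the tight closure of zero in E -/

theorem mainTheorem8 (p : ℕ) [Fact p.Prime]
    (R : Type u) [CommRing R] [IsDomain R] [IsNoetherianRing R] [IsLocalRing R]
    [IsIntegrallyClosed R] [CharP R p] (hF : (frobenius R p).Finite)
    (K : Type w) [Field K] [Algebra R K] [IsFractionRing R K]
    (Δ : FPairs.QWeilDivisor R) (hΔ : 0 ≤ Δ)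
    (E : Type u) [AddCommGroup E] [Module R E] (ι : IsLocalRing.ResidueField R →ₗ[R] E)
    (hι : FPairs.IsInjectiveHull ι) :
    FPairs.IsStronglyFRegular K p hΔ ↔
      FPairs.tightClosure K p hΔ (⊥ : Submodule R E) = ⊥ := by
  have hbot : ∀ e, FPairs.frobeniusImage K p e Δ (⊥ : Submodule R E) = ⊥ := fun e => by
    rw [FPairs.frobeniusImage, LinearMap.range_eq_bot]
    have : (⊥ : Submodule R E).subtype = 0 := LinearMap.ext fun x => (Submodule.mem_bot R).mp x.2
    rw [this, LinearMap.rTensor_zero]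
  constructor
  · intro h
    rw [eq_bot_iff]
    rintro z ⟨c, hc, hz⟩
    obtain ⟨n, hn⟩ := Filter.eventually_atTop.mp hz
    obtain ⟨e, he, φ, hφ⟩ := h.exists_ge hc n
    have h0 := hn e he
    rw [hbot, Submodule.mem_bot] at h0
    -- Under E ⊗ R ≅ E, id ⊗ φ sends z ⊗ c^{1/q} to z.
    have := congrArg ((TensorProduct.rid R E).toLinearMap ∘ₗ LinearMap.lTensor E φ) h0
    simpa [hφ] using this
  · intro h
    rw [FPairs.isStronglyFRegular_iff]
    intro c hc
    have hι1 : ι 1 ≠ 0 := fun h0 => one_ne_zero (hι.injective_map (h0.trans (map_zero ι).symm))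
    have hnot : ι 1 ∉ FPairs.tightClosure K p hΔ (⊥ : Submodule R E) := by
      rw [h]
      exact fun h0 => hι1 ((Submodule.mem_bot R).mp h0)
    by_contra! hcon
    -- The unsplit c itself is the multiplier, and it works for all e.
    refine hnot ⟨c, hc, Filter.Eventually.of_forall fun e => ?_⟩
    rw [hbot, Submodule.mem_bot]
    by_contra hne
    have := FPairs.finite_frobeniusTwist K hF e Δ
    obtain ⟨φ, hφ⟩ := hι.exists_apply_eq_one _ hne
    exact hcon e φ hφ
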